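/- All graphs are finite and simple; $\rho(G)$ denotes the spectral radius of the adjacency matrix of $G$, and $W^{\ell}(G)$ the number of walks $v_0,v_1,\dots,v_\ell$ of length $\ell$ in $G$. For a set $\mathcal{A}$ of graphs let $\mathrm{SPEX}(\mathcal{A})$ be the set of the graphs in $\mathcal{A}$ with maximum spectral radius. Let $\mathrm{EX}^{1}(\mathcal{A})$ be the set of the $G\in\mathcal{A}$ with $W^{1}(G)\ge W^{1}(G')$ for all $G'\in\mathcal{A}$; for $\ell\ge 2$ let $\mathrm{EX}^{\ell}(\mathcal{A})$ be the set of the $G\in\mathrm{EX}^{\ell-1}(\mathcal{A})$ with $W^{\ell}(G)\ge W^{\ell}(G')$ for all $G'\in\mathrm{EX}^{\ell-1}(\mathcal{A})$; and let $\mathrm{EX}^{\infty}(\mathcal{A})=\bigcap_{\ell\ge1}\mathrm{EX}^{\ell}(\mathcal{A})$ (the most walk-preferable graphs in $\mathcal{A}$). Let $T(n,r)$ be the Turán graph of order $n$ with parts $V_1,\dots,V_r$ of sizes $\lfloor n/r\rfloor=n_1\le n_2\le\dots\le n_r=\lceil n/r\rceil$, and let $\mathcal{T}_{n,r,t}$ be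 the set of all graphs obtained from $T(n,r)$ by embedding (adding) $t$ edges inside the parts. For $G\in\mathcal{T}_{n,r,t}$ let $H^{G}_i$ be the graph formed by the edges of $G$ inside $V_i$, and let $H^{G}=\bigcup_{i}H^{G}_i$. For $\mathcal{G}\subseteq\mathcal{T}_{n,r,t}$ and $1\le i\le r$ put $\mathcal{G}_i=\{G\in\mathcal{G} : H^{G}=H^{G}_i\}$, $\mathcal{H}^{\mathcal{G}}=\{H^{G} : G\in\mathcal{G}\}$ and $\mathcal{H}^{\mathcal{G}_i}=\{H^{G} : G\in\mathcal{G}_i\}$. The set $\mathcal{G}$ is called normal if for all $i\ne j$ and all $G\in\mathcal{G}_i$ there is a $G'\in\mathcal{G}_j$ such that $H^{G'}=H^{G'}_j$ is a copy of (isomorphic to) $H^{G}=H^{G}_i$. **Theorem.** Let $t\ge 1$ and $r\ge 2$. There is an $N=N(t,r)$ such that the following holds for all $n\ge N$ and every normal subset $\mathcal{G}$ of $\mathcal{T}_{n,r,t}$. If $$\{G\in\mathcal{G} : H^{G}\in\mathrm{EX}^{2}(\mathcal{H}^{\mathcal{G}})\}\subseteq\bigcup_{1\le i\le r}\mathcal{G}_i,$$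 then (i) $\displaystyle \mathrm{SPEX}(\mathcal{G})=\bigcup_{i\,:\,n_i=\lfloor n/r\rfloor}\mathrm{SPEX}(\mathcal{G}_i)$; (ii) for every $1\le i\le r$ and every $G\in\mathcal{G}_i$, we have $G\in\mathrm{SPEX}(\mathcal{G}_i)$ if and only if $H^{G}\in\mathrm{EX}^{\infty}(\mathcal{H}^{\mathcal{G}_i})$. -/

import Mathlib

open scoped ENNReal

namespace SpectralTuran

open SimpleGraph

noncomputable section

/-! ### Spectral radius and walks -/

section Graphs

variable {V : Type} [Fintype V]

open Classical in
/-- The spectral radius of a finite graph: the largest absolute value of an eigenvalue of its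
adjacency matrix (a real symmetric matrix, so all its eigenvalues are real). -/
def rho (G : SimpleGraph V) : ℝ≥0∞ :=
  spectralRadius ℝ (G.adjMatrix ℝ)

/-- The set of the graphs of maximum spectral radius in a set of graphs. -/
def SPEX (𝒢 : Set (SimpleGraph V)) : Set (SimpleGraph V) :=
  {G | G ∈ 𝒢 ∧ ∀ G' ∈ 𝒢, rho G' ≤ rho G}

/-- The number of walks of length `ℓ` in `G` that start at `u`. -/
def walksFrom (G : SimpleGraph V) (ℓ : ℕ) (u : V) : ℕ :=
  ∑ v : V, Nat.card {p : G.Walk u v // p.length = ℓ}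

/-- The number of all walks of length `ℓ` in `G`. -/
def W (ℓ : ℕ) (G : SimpleGraph V) : ℕ :=
  ∑ u : V, walksFrom G ℓ u

/-- `EX ℓ 𝒢`: the graphs of `𝒢` that survive when one maximizes successively the numbers of walks
of length `1, 2, …, ℓ`. The value at `ℓ = 0` is `𝒢` itself, so that `EX 1 𝒢` is the set of the
graphs with the maximum number of walks of length `1` in `𝒢`. -/
def EX : ℕ → Set (SimpleGraph V) → Set (SimpleGraph V)
  | 0, 𝒢 => 𝒢
  | ℓ + 1, 𝒢 => {G | G ∈ EX ℓ 𝒢 ∧ ∀ G' ∈ EX ℓ 𝒢, W (ℓ + 1) G' ≤ W (ℓ + 1) G}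

/-- The most walk-preferable graphs in `𝒢`. -/
def EXinf (𝒢 : Set (SimpleGraph V)) : Set (SimpleGraph V) :=
  {G | ∀ ℓ : ℕ, 1 ≤ ℓ → G ∈ EX ℓ 𝒢}

/-- `H'` is a copy of `H`, where both are regarded as the graphs formed by their edges (isolated
vertices are dropped). -/
def IsCopy (H' H : SimpleGraph V) : Prop :=
  Nonempty (H'.induce H'.support ≃g H.induce H.support)

end Graphs

/-! ### Embedding edges into the Turán graph -/

/-- The parts `V_i` of the Turán graph `turanGraph n r` on `Fin n`, whose classes are the residue
classes modulo `r`. They are numbered so that their sizes are nondecreasing in `i`, from `⌊n/r⌋`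
to `⌈n/r⌉`. -/
def part (n r : ℕ) (i : Fin r) : Finset (Fin n) :=
  Finset.univ.filter fun v => (v : ℕ) % r = (Fin.rev i : ℕ)

/-- The graph `H^G_i` formed by the edges of `G` inside the part `V_i`. All graphs are kept on the
vertex set `Fin n`; isolated vertices play no role for walks of length at least `1`. -/
def embeddedPart {n : ℕ} (r : ℕ) (G : SimpleGraph (Fin n)) (i : Fin r) : SimpleGraph (Fin n) where
  Adj u v := G.Adj u v ∧ u ∈ part n r i ∧ v ∈ part n r i
  symm := ⟨fun _ _ h => ⟨h.1.symm, h.2.2, h.2.1⟩⟩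
  loopless := ⟨fun _ h => h.1.ne rfl⟩

/-- The embedded graph `H^G`, the union of the graphs `H^G_i`. -/
def embedded {n : ℕ} (r : ℕ) (G : SimpleGraph (Fin n)) : SimpleGraph (Fin n) :=
  ⨆ i : Fin r, embeddedPart r G i

/-- The set of the graphs obtained from the Turán graph `T(n,r)` by embedding `t` edges into its
parts. -/
def turanEmbed (n r t : ℕ) : Set (SimpleGraph (Fin n)) :=
  {G | turanGraph n r ≤ G ∧ (embedded r G).edgeSet.ncard = t}

/-- `𝒢_i`: the graphs of `𝒢` all of whose embedded edges lie in the part `V_i`. -/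
def inPart {n r : ℕ} (𝒢 : Set (SimpleGraph (Fin n))) (i : Fin r) : Set (SimpleGraph (Fin n)) :=
  {G | G ∈ 𝒢 ∧ embedded r G = embeddedPart r G i}

/-- The set `{H^G | G ∈ 𝒢}` of the embedded graphs of the members of `𝒢`. -/
def embeddedSet {n : ℕ} (r : ℕ) (𝒢 : Set (SimpleGraph (Fin n))) : Set (SimpleGraph (Fin n)) :=
  embedded r '' 𝒢

/-- Normal subsets of the set of all graphs obtained from `T(n,r)` by embedding `t` edges. -/
def IsNormal (n r t : ℕ) (𝒢 : Set (SimpleGraph (Fin n))) : Prop :=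
  𝒢 ⊆ turanEmbed n r t ∧
    ∀ i j : Fin r, i ≠ j → ∀ G ∈ inPart 𝒢 i,
      ∃ G' ∈ inPart 𝒢 j, IsCopy (embedded r G') (embedded r G)

end

end SpectralTuran

open SpectralTuran

open scoped ENNReal

namespace SpectralTuran

open SimpleGraph

noncomputable section

/-! ### Counting walks -/

section Walks

variable {V : Type} [Fintype V]

/-! Write `q = ⌊n/r⌋`, and let `w_i(x) = ∑_{l ≥ 1} W^l(H_i) x^{-l}` be the walk series of the graph
embedded in `V_i`. Solving the eigenvector equation of `G` part by part gives a positive eigenvector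
as soon as `∑_i x / (x + |V_i| + w_i(x)) = r - 1`, and then `x` is the spectral radius
(`rho_eq_of_turanSum_eq`). A root with `x ≥ q` exists by the intermediate value theorem, so a graph
whose sum is smaller at every `x ≥ q` has the larger spectral radius (`rho_lt_of_turanSum_lt`).

For (ii), all edges lie in one fixed part, so only one term of the sum varies, and it decreases in
the walk series. For large `x` walk series are ordered as their coefficients are lexicographically,
with a uniform bound because only finitely many graphs occur up to isolated vertices
(`exists_forall_walkSeries_lt`).

For (i), compare `G` with a copy, placed in a part of size `q`, of an embedded graph with the most
walks of length 2. All members have `W^1 = 2t`. If `G` has fewer walks of length 2, its total walk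
series is smaller by order `x^{-2}`, which dominates all errors. If it has equally many, its edges
lie in one part by hypothesis; were that part of size `q + 1`, the larger denominator would cost
more than the `O(x^{-3})` by which the series can differ. -/

open Classical in
theorem walksFrom_eq_sum_pow (G : SimpleGraph V) (l : ℕ) (u : V) :
    walksFrom G l u = ∑ v, (G.adjMatrix ℕ ^ l) u v := by
  unfold walksFrom
  refine Finset.sum_congr rfl fun v _ => ?_
  have h := G.adjMatrix_pow_apply_eq_card_walk (α := ℕ) l u v
  rw [h, Nat.card_eq_fintype_card]
  simp only [Nat.cast_id]
  rfl

@[simp]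
theorem walksFrom_zero (G : SimpleGraph V) (u : V) : walksFrom G 0 u = 1 := by
  classical
  simp [walksFrom_eq_sum_pow, Matrix.one_apply]

open Classical in
theorem walksFrom_succ (G : SimpleGraph V) (l : ℕ) (u : V) :
    walksFrom G (l + 1) u = ∑ v, if G.Adj u v then walksFrom G l v else 0 := by
  simp_rw [walksFrom_eq_sum_pow, pow_succ', Matrix.mul_apply, adjMatrix_apply]
  rw [Finset.sum_comm]
  refine Finset.sum_congr rfl fun v _ => ?_
  split_ifs <;> simp

theorem walksFrom_bot (l : ℕ) (u : V) : walksFrom (⊥ : SimpleGraph V) (l + 1) u = 0 := by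
  simp [walksFrom_succ]

theorem W_bot (l : ℕ) : W (l + 1) (⊥ : SimpleGraph V) = 0 := by
  simp [W, walksFrom_bot]

theorem walksFrom_le_W (G : SimpleGraph V) (l : ℕ) (u : V) : walksFrom G l u ≤ W l G :=
  Finset.single_le_sum (f := walksFrom G l) (fun _ _ => Nat.zero_le _) (Finset.mem_univ u)

theorem W_succ_eq (G : SimpleGraph V) (l : ℕ) :
    W (l + 1) G = ∑ v, walksFrom G 1 v * walksFrom G l v := by
  classical
  unfold W
  simp_rw [walksFrom_succ]
  rw [Finset.sum_comm]
  refine Finset.sum_congr rfl fun v _ => ?_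
  rw [Finset.sum_mul]
  refine Finset.sum_congr rfl fun u _ => ?_
  simp [G.adj_comm u v]

theorem W_succ_le (G : SimpleGraph V) (l : ℕ) : W (l + 1) G ≤ W 1 G * W l G := by
  rw [W_succ_eq, W, W, Finset.mul_sum]
  exact Finset.sum_le_sum fun v _ => Nat.mul_le_mul_right _ (walksFrom_le_W G 1 v)

theorem W_le_pow (G : SimpleGraph V) (l : ℕ) : W (l + 1) G ≤ W 1 G ^ (l + 1) := by
  induction l with
  | zero => simp
  | succ l ih =>
    calc W (l + 1 + 1) G ≤ W 1 G * W (l + 1) G := W_succ_le G _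
      _ ≤ W 1 G * W 1 G ^ (l + 1) := Nat.mul_le_mul_left _ ih
      _ = _ := by ring

theorem walksFrom_le_pow (G : SimpleGraph V) (l : ℕ) (u : V) : walksFrom G l u ≤ W 1 G ^ l := by
  cases l with
  | zero => simp
  | succ l => exact (walksFrom_le_W G _ u).trans (W_le_pow G l)

theorem W_one (G : SimpleGraph V) : W 1 G = 2 * G.edgeSet.ncard := by
  classical
  have h := G.sum_degrees_eq_twice_card_edges
  rw [← coe_edgeFinset, Set.ncard_coe_finset, ← h, W]
  refine Finset.sum_congr rfl fun v _ => ?_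
  rw [walksFrom_succ]
  simp [← card_neighborFinset_eq_degree, neighborFinset_eq_filter]

theorem walksFrom_map {V' : Type} [Fintype V'] (G : SimpleGraph V) (f : V ↪ V') (l : ℕ) (u : V) :
    walksFrom (G.map f) l (f u) = walksFrom G l u := by
  classical
  induction l generalizing u with
  | zero => simp
  | succ l ih =>
    rw [walksFrom_succ, walksFrom_succ]
    symm
    refine Finset.sum_of_injOn f f.injective.injOn (by simp) ?_ ?_
    · intro w _ hw
      rw [if_neg]
      rintro ⟨-, a, b, -, -, rfl⟩
      exact hw (by simp)
    · intro v _
      simp [ih]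

/-- Vertices outside the range of `f` are isolated: they start no walk of positive length, but they
would count at length zero. -/
theorem W_map {V' : Type} [Fintype V'] (G : SimpleGraph V) (f : V ↪ V') (l : ℕ) :
    W (l + 1) (G.map f) = W (l + 1) G := by
  classical
  symm
  refine Finset.sum_of_injOn f f.injective.injOn (by simp) ?_ ?_
  · intro w _ hw
    rw [walksFrom_succ]
    refine Finset.sum_eq_zero fun v _ => ?_
    rw [if_neg]
    rintro ⟨-, a, b, -, rfl, rfl⟩
    exact hw (by simp)
  · intro v _
    rw [walksFrom_map]

theorem W_induce_support (G : SimpleGraph V) [Fintype G.support] (l : ℕ) :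
    W (l + 1) (G.induce G.support) = W (l + 1) G := by
  rw [← W_map _ (Function.Embedding.subtype _)]
  congr 1
  ext u v
  constructor
  · rintro ⟨-, a, b, h, rfl, rfl⟩
    exact h
  · intro h
    exact ⟨h.ne, ⟨u, v, h⟩, ⟨v, u, h.symm⟩, h, rfl, rfl⟩

theorem W_iso {V' : Type} [Fintype V'] {G : SimpleGraph V} {G' : SimpleGraph V'} (e : G ≃g G')
    (l : ℕ) : W (l + 1) G = W (l + 1) G' := by
  rw [← W_map G e.toEquiv.toEmbedding]
  congr 1
  ext u v
  constructor
  · rintro ⟨-, a, b, h, rfl, rfl⟩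
    exact e.map_adj_iff.2 h
  · intro h
    refine ⟨h.ne, e.symm u, e.symm v, e.symm.map_adj_iff.2 h, ?_, ?_⟩ <;> simp

theorem IsCopy.W_eq {G G' : SimpleGraph V} (h : IsCopy G G') (l : ℕ) :
    W (l + 1) G = W (l + 1) G' := by
  classical
  obtain ⟨e⟩ := h
  rw [← W_induce_support G, ← W_induce_support G', W_iso e]

theorem card_support_le (G : SimpleGraph V) [Fintype G.support] :
    Fintype.card G.support ≤ W 1 G := by
  classical
  rw [W, ← Set.toFinset_card, Finset.card_eq_sum_ones]
  refine (Finset.sum_le_sum fun v hv => ?_).trans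
    (Finset.sum_le_sum_of_subset (Finset.subset_univ _))
  rw [Set.mem_toFinset] at hv
  obtain ⟨w, hw⟩ := G.mem_support.1 hv
  rw [walksFrom_succ]
  refine le_trans ?_ (Finset.single_le_sum (fun _ _ => Nat.zero_le _) (Finset.mem_univ w))
  simp [hw]

/-- Up to isolated vertices, a graph with `k` ordered pairs of adjacent vertices is a graph on
`Fin k`. -/
theorem exists_fin_W_eq (G : SimpleGraph V) {k : ℕ} (hk : W 1 G ≤ k) :
    ∃ K : SimpleGraph (Fin k), ∀ l, W (l + 1) K = W (l + 1) G := by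
  classical
  have h : Fintype.card G.support ≤ Fintype.card (Fin k) := by
    simpa using (card_support_le G).trans hk
  obtain ⟨f⟩ := Function.Embedding.nonempty_of_card_le h
  exact ⟨(G.induce G.support).map f, fun l => by rw [W_map, W_induce_support]⟩

end Walks

/-! ### Walk generating functions -/

section Series

variable {V : Type} [Fintype V]

/-- The generating function of the numbers of walks of positive length, in `x⁻¹`. -/
def walkSeries (G : SimpleGraph V) (x : ℝ) : ℝ :=
  ∑' l : ℕ, (W (l + 1) G : ℝ) * x⁻¹ ^ (l + 1)

theorem walkSeries_congr {V' : Type} [Fintype V'] {G : SimpleGraph V} {G' : SimpleGraph V'}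
    (h : ∀ l, W (l + 1) G = W (l + 1) G') : walkSeries G = walkSeries G' := by
  funext x
  simp [walkSeries, h]

theorem walkSeries_bot : walkSeries (⊥ : SimpleGraph V) = 0 := by
  funext x
  simp [walkSeries, W_bot]

theorem walkSeries_nonneg (G : SimpleGraph V) {x : ℝ} (hx : 0 ≤ x) : 0 ≤ walkSeries G x :=
  tsum_nonneg fun _ => by positivity

theorem W_mul_le (G : SimpleGraph V) {k : ℕ} (hk : W 1 G ≤ k) (l : ℕ) {x : ℝ} (hx : 0 ≤ x) :
    (W (l + 1) G : ℝ) * x⁻¹ ^ (l + 1) ≤ (k / x) ^ (l + 1) := by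
  have h : (W (l + 1) G : ℝ) ≤ (k : ℝ) ^ (l + 1) := by
    exact_mod_cast (W_le_pow G l).trans (Nat.pow_le_pow_left hk _)
  calc (W (l + 1) G : ℝ) * x⁻¹ ^ (l + 1) ≤ (k : ℝ) ^ (l + 1) * x⁻¹ ^ (l + 1) := by gcongr
    _ = _ := by rw [← mul_pow, div_eq_mul_inv]

theorem summable_walkSeries (G : SimpleGraph V) {x : ℝ} (hx : (W 1 G : ℝ) < x) :
    Summable fun l : ℕ => (W (l + 1) G : ℝ) * x⁻¹ ^ (l + 1) := by
  have hx0 : 0 < x := lt_of_le_of_lt (Nat.cast_nonneg _) hx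
  refine Summable.of_nonneg_of_le (fun _ => by positivity)
    (fun l => W_mul_le G le_rfl l hx0.le) ?_
  exact (summable_nat_add_iff 1).2
    (summable_geometric_of_lt_one (by positivity) ((div_lt_one hx0).2 hx))

theorem sum_le_walkSeries (G : SimpleGraph V) {x : ℝ} (hx : (W 1 G : ℝ) < x) (m : ℕ) :
    ∑ l ∈ Finset.range m, (W (l + 1) G : ℝ) * x⁻¹ ^ (l + 1) ≤ walkSeries G x := by
  have hx0 : 0 < x := lt_of_le_of_lt (Nat.cast_nonneg _) hx
  exact (summable_walkSeries G hx).sum_le_tsum _ fun _ _ => by positivity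

/-- Since `W (l + 1) G ≤ k ^ (l + 1)`, the tail is dominated by a geometric series of ratio `k / x ≤
1 / 2`. -/
theorem walkSeries_le_sum_add (G : SimpleGraph V) {k : ℕ} (hk : W 1 G ≤ k) (hk0 : 1 ≤ k) {x : ℝ}
    (hx : 2 * (k : ℝ) ≤ x) (m : ℕ) :
    walkSeries G x ≤ ∑ l ∈ Finset.range m, (W (l + 1) G : ℝ) * x⁻¹ ^ (l + 1)
      + 2 * (k / x) ^ (m + 1) := by
  have hk0' : (1 : ℝ) ≤ k := by exact_mod_cast hk0
  have hk' : (W 1 G : ℝ) ≤ k := by exact_mod_cast hk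
  have hx0 : 0 < x := by linarith
  have hs := summable_walkSeries G (x := x) (by linarith)
  rw [walkSeries, ← hs.sum_add_tsum_nat_add m]
  gcongr
  have hle : (k : ℝ) / x ≤ 1 / 2 := by rw [div_le_iff₀ hx0]; linarith
  have hg : Summable fun l : ℕ => ((k : ℝ) / x) ^ (m + 1) * (1 / 2 : ℝ) ^ l :=
    summable_geometric_two.mul_left _
  calc ∑' l : ℕ, (W (l + m + 1) G : ℝ) * x⁻¹ ^ (l + m + 1)
      ≤ ∑' l : ℕ, ((k : ℝ) / x) ^ (m + 1) * (1 / 2 : ℝ) ^ l := by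
        refine ((summable_nat_add_iff m).2 hs).tsum_le_tsum (fun l => ?_) hg
        refine (W_mul_le G hk (l + m) hx0.le).trans ?_
        rw [show l + m + 1 = (m + 1) + l by ring, pow_add]
        gcongr
    _ = 2 * (k / x) ^ (m + 1) := by rw [tsum_mul_left, tsum_geometric_two]; ring

theorem continuousOn_walkSeries (G : SimpleGraph V) {a : ℝ} (ha : (W 1 G : ℝ) < a) :
    ContinuousOn (walkSeries G) (Set.Ici a) := by
  have ha0 : 0 < a := lt_of_le_of_lt (Nat.cast_nonneg _) ha
  refine continuousOn_tsum (u := fun l => (W (l + 1) G : ℝ) * a⁻¹ ^ (l + 1)) ?_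
    (summable_walkSeries G ha) ?_
  · intro l
    refine continuousOn_const.mul (ContinuousOn.pow ?_ _)
    exact continuousOn_inv₀.mono fun x hx => (ha0.trans_le hx).ne'
  · intro l x hx
    have hx0 : 0 < x := ha0.trans_le hx
    rw [Real.norm_of_nonneg (by positivity)]
    have : x⁻¹ ≤ a⁻¹ := inv_anti₀ ha0 hx
    gcongr

end Series

/-! ### Spectral radius from a positive eigenvector -/

section Perron

variable {V : Type} [Fintype V]

/-- A real number is the spectral radius of a symmetric nonnegative matrix if it belongs to a
positive eigenvector. -/
theorem spectralRadius_eq_of_pos_eigenvector [DecidableEq V] [Nonempty V] (A : Matrix V V ℝ)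
    (hsymm : A.IsSymm) (hA : ∀ u v, 0 ≤ A u v) {x : V → ℝ} (hx : ∀ u, 0 < x u) {a : ℝ}
    (ha : 0 ≤ a) (h : A.mulVec x = a • x) : spectralRadius ℝ A = ENNReal.ofReal a := by
  have key : ∀ μ : ℝ, μ ∈ spectrum ℝ A ↔ ∃ y : V → ℝ, y ≠ 0 ∧ A.mulVec y = μ • y := by
    intro μ
    rw [← Matrix.spectrum_toLin', ← Module.End.hasEigenvalue_iff_mem_spectrum]
    constructor
    · intro hμ
      obtain ⟨y, hy⟩ := hμ.exists_hasEigenvector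
      exact ⟨y, hy.2, by simpa using hy.apply_eq_smul⟩
    · rintro ⟨y, hy0, hy⟩
      exact Module.End.hasEigenvalue_of_hasEigenvector (x := y)
        ⟨Module.End.mem_eigenspace_iff.2 (by simpa using hy), hy0⟩
  have hx0 : x ≠ 0 := fun h0 => by
    obtain ⟨u⟩ := ‹Nonempty V›
    simpa [h0] using hx u
  refine le_antisymm (iSup₂_le fun μ hμ => ?_) ?_
  · obtain ⟨y, hy0, hy⟩ := (key μ).1 hμ
    have hpos : 0 < ∑ u, x u * |y u| := by
      obtain ⟨u, hu⟩ := Function.ne_iff.1 hy0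
      exact Finset.sum_pos' (fun v _ => mul_nonneg (hx v).le (abs_nonneg _))
        ⟨u, Finset.mem_univ _, mul_pos (hx u) (abs_pos.2 hu)⟩
    -- Pair `|A y| ≤ A |y|` with the positive eigenvector `x` and move `A` across by symmetry.
    have h1 : |μ| * ∑ u, x u * |y u| ≤ a * ∑ u, x u * |y u| := by
      calc |μ| * ∑ u, x u * |y u| = ∑ u, x u * |A.mulVec y u| := by
            rw [hy, Finset.mul_sum]
            refine Finset.sum_congr rfl fun u _ => ?_
            rw [Pi.smul_apply, smul_eq_mul, abs_mul]
            ring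
        _ ≤ ∑ u, x u * ∑ v, A u v * |y v| := by
            refine Finset.sum_le_sum fun u _ => mul_le_mul_of_nonneg_left ?_ (hx u).le
            refine (Finset.abs_sum_le_sum_abs _ _).trans (Finset.sum_le_sum fun v _ => ?_)
            rw [abs_mul, abs_of_nonneg (hA u v)]
        _ = ∑ v, A.mulVec x v * |y v| := by
            simp_rw [Matrix.mulVec, dotProduct, Finset.mul_sum, Finset.sum_mul]
            rw [Finset.sum_comm]
            refine Finset.sum_congr rfl fun v _ => Finset.sum_congr rfl fun u _ => ?_
            rw [hsymm.apply]
            ring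
        _ = a * ∑ u, x u * |y u| := by
            rw [h, Finset.mul_sum]
            refine Finset.sum_congr rfl fun u _ => ?_
            rw [Pi.smul_apply, smul_eq_mul]
            ring
    have h2 : |μ| ≤ a := le_of_mul_le_mul_right h1 hpos
    rw [← enorm_eq_nnnorm, Real.enorm_eq_ofReal_abs]
    exact ENNReal.ofReal_le_ofReal h2
  · have h3 : a ∈ spectrum ℝ A := (key a).2 ⟨x, hx0, h⟩
    refine le_trans (le_of_eq ?_) (le_iSup₂ (f := fun k (_ : k ∈ spectrum ℝ A) => (‖k‖₊ : ℝ≥0∞)) a h3)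
    rw [← enorm_eq_nnnorm, Real.enorm_eq_ofReal_abs, abs_of_nonneg ha]

end Perron

/-! ### Eigenvectors of joins -/

section Join

variable {V : Type} [Fintype V]

/-- The generating function, in `x⁻¹`, of the numbers of walks that start at `u`. -/
def vertexSeries (H : SimpleGraph V) (x : ℝ) (u : V) : ℝ :=
  ∑' l : ℕ, (walksFrom H l u : ℝ) * x⁻¹ ^ l

theorem summable_vertexSeries (H : SimpleGraph V) {x : ℝ} (hx : (W 1 H : ℝ) < x) (u : V) :
    Summable fun l : ℕ => (walksFrom H l u : ℝ) * x⁻¹ ^ l := by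
  have hx0 : 0 < x := lt_of_le_of_lt (Nat.cast_nonneg _) hx
  refine Summable.of_nonneg_of_le (fun _ => by positivity) (fun l => ?_)
    (summable_geometric_of_lt_one (r := (W 1 H : ℝ) / x) (by positivity) ((div_lt_one hx0).2 hx))
  rw [div_eq_mul_inv, mul_pow]
  gcongr
  exact_mod_cast walksFrom_le_pow H l u

theorem vertexSeries_pos (H : SimpleGraph V) {x : ℝ} (hx : (W 1 H : ℝ) < x) (u : V) :
    0 < vertexSeries H x u := by
  have hx0 : 0 < x := lt_of_le_of_lt (Nat.cast_nonneg _) hx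
  exact (summable_vertexSeries H hx u).tsum_pos (fun _ => by positivity) 0 (by simp)

-- Removing the first step of a walk shows that the vertex series solve `(x - A) h = x • 1`, where
-- `A` is the adjacency matrix of `H`.
open Classical in
theorem mul_vertexSeries (H : SimpleGraph V) {x : ℝ} (hx : (W 1 H : ℝ) < x) (u : V) :
    x * vertexSeries H x u = x + ∑ v, if H.Adj u v then vertexSeries H x v else 0 := by
  have hx0 : 0 < x := lt_of_le_of_lt (Nat.cast_nonneg _) hx
  have h1 : ∀ v, Summable fun l : ℕ => if H.Adj u v then (walksFrom H l v : ℝ) * x⁻¹ ^ l else 0 := by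
    intro v
    split_ifs
    · exact summable_vertexSeries H hx v
    · exact summable_zero
  have h2 : (∑ v, if H.Adj u v then vertexSeries H x v else 0)
      = ∑' l : ℕ, (walksFrom H (l + 1) u : ℝ) * x⁻¹ ^ l := by
    calc (∑ v, if H.Adj u v then vertexSeries H x v else 0)
        = ∑ v, ∑' l : ℕ, if H.Adj u v then (walksFrom H l v : ℝ) * x⁻¹ ^ l else 0 := by
          refine Finset.sum_congr rfl fun v _ => ?_
          split_ifs
          · rfl
          · simp
      _ = ∑' l : ℕ, ∑ v, if H.Adj u v then (walksFrom H l v : ℝ) * x⁻¹ ^ l else 0 :=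
          (Summable.tsum_finsetSum fun v _ => h1 v).symm
      _ = _ := by
          refine tsum_congr fun l => ?_
          rw [walksFrom_succ, Nat.cast_sum, Finset.sum_mul]
          refine Finset.sum_congr rfl fun v _ => ?_
          split_ifs <;> simp
  rw [h2, vertexSeries, (summable_vertexSeries H hx u).tsum_eq_zero_add, mul_add, ← tsum_mul_left]
  congr 1
  · simp
  · refine tsum_congr fun l => ?_
    rw [pow_succ]
    field_simp

/-- The spectral radius of the join of graphs, the colour classes of `c`, as the root of an
equation in the walk generating functions of these graphs. -/
theorem rho_eq_of_sum_eq [Nonempty V] {r : ℕ} (c : V → Fin r) {G H : SimpleGraph V}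
    (hG : ∀ u v, G.Adj u v ↔ c u ≠ c v ∨ H.Adj u v) (hH : ∀ u v, H.Adj u v → c u = c v)
    {x : ℝ} (hx : (W 1 H : ℝ) < x)
    (h : ∑ i, x / (x + ∑ u with c u = i, vertexSeries H x u) = r - 1) :
    rho G = ENNReal.ofReal x := by
  classical
  have hx0 : 0 < x := lt_of_le_of_lt (Nat.cast_nonneg _) hx
  set P : Fin r → ℝ := fun i => ∑ u with c u = i, vertexSeries H x u with hP
  have hP0 : ∀ i, 0 ≤ P i := fun i => Finset.sum_nonneg fun u _ => (vertexSeries_pos H hx u).le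
  have hden : ∀ i, 0 < x + P i := fun i => by linarith [hP0 i]
  -- If `z` has total `S` and class sums `S_i`, the eigenvector equation on class `i` reads `(x -
  -- A_H) z = (S - S_i) • 1`, so `z` is a multiple of the vertex series there. Normalizing `S = x`
  -- forces the factor `x / (x + P i)`.
  set z : V → ℝ := fun u => x / (x + P (c u)) * vertexSeries H x u with hz
  have hzpos : ∀ u, 0 < z u := fun u =>
    mul_pos (div_pos hx0 (hden _)) (vertexSeries_pos H hx u)
  have hclass : ∀ i, ∑ u with c u = i, z u = x - x * (x / (x + P i)) := by
    intro i
    have : ∑ u with c u = i, z u = x / (x + P i) * P i := by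
      simp only [hP]
      rw [Finset.mul_sum]
      refine Finset.sum_congr rfl fun u hu => ?_
      rw [← (Finset.mem_filter.1 hu).2]
    rw [this]
    field_simp [(hden i).ne']
    ring
  -- Only here is the equation `h` used: the class sums add up to `r x - (r - 1) x`.
  have htotal : ∑ u, z u = x := by
    rw [← Finset.sum_fiberwise Finset.univ c z, Finset.sum_congr rfl fun i _ => hclass i,
      Finset.sum_sub_distrib, ← Finset.mul_sum]
    simp only [hP]
    rw [h]
    simp
    ring
  unfold rho
  refine spectralRadius_eq_of_pos_eigenvector _ (G.isSymm_adjMatrix) ?_ hzpos hx0.le ?_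
  · intro u v
    rw [adjMatrix_apply]
    split_ifs <;> simp
  · funext u
    rw [Pi.smul_apply, smul_eq_mul]
    have h1 : ((G.adjMatrix ℝ).mulVec z) u = ∑ v, if G.Adj u v then z v else 0 := by
      simp only [Matrix.mulVec, dotProduct, adjMatrix_apply]
      refine Finset.sum_congr rfl fun v _ => ?_
      split_ifs <;> simp
    have h2 : ∀ v, (if G.Adj u v then z v else 0) =
        z v - (if c v = c u then z v else 0)
          + x / (x + P (c u)) * (if H.Adj u v then vertexSeries H x v else 0) := by
      intro v
      by_cases hc : c u = c v
      · simp [hG, hc, hz]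
      · have : ¬ H.Adj u v := fun h' => hc (hH u v h')
        simp [hG, hc, this, Ne.symm hc]
    rw [h1, Finset.sum_congr rfl fun v _ => h2 v, Finset.sum_add_distrib, Finset.sum_sub_distrib,
      ← Finset.mul_sum, ← Finset.sum_filter, htotal, hclass,
      show (∑ v, if H.Adj u v then vertexSeries H x v else 0) = x * vertexSeries H x u - x by
        rw [mul_vertexSeries H hx]; ring]
    simp only [hz]
    ring

end Join

/-! ### The spectral radius of a Turán graph with embedded edges -/

section Turan

variable {n r t : ℕ}

/-- The index of the part of the Turán graph that contains a given vertex. -/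
def partIndex (hr : 0 < r) (v : Fin n) : Fin r :=
  Fin.rev ⟨v % r, Nat.mod_lt _ hr⟩

theorem mem_part_iff (hr : 0 < r) (v : Fin n) (i : Fin r) :
    v ∈ part n r i ↔ partIndex hr v = i := by
  rw [part, Finset.mem_filter, partIndex, Fin.rev_eq_iff, Fin.ext_iff]
  simp

theorem part_eq_filter (hr : 0 < r) (i : Fin r) :
    part n r i = Finset.univ.filter fun v => partIndex hr v = i := by
  ext v
  simp [mem_part_iff hr]

theorem partIndex_eq_iff (hr : 0 < r) (u v : Fin n) :
    partIndex hr u = partIndex hr v ↔ (u : ℕ) % r = v % r := by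
  simp [partIndex]

theorem card_part (hr : 0 < r) (i : Fin r) :
    (part n r i).card = n / r + if (Fin.rev i : ℕ) < n % r then 1 else 0 := by
  have h := Nat.count_modEq_card n hr (Fin.rev i : ℕ)
  rw [Nat.mod_eq_of_lt (Fin.rev i).2] at h
  rw [← h, Nat.count_eq_card_filter_range, part, ← Finset.card_map Fin.valEmbedding]
  congr 1
  ext m
  simp only [Finset.mem_map, Finset.mem_filter, Finset.mem_univ, true_and, Fin.valEmbedding_apply,
    Finset.mem_range, Nat.ModEq, Nat.mod_eq_of_lt (Fin.rev i).2]
  constructor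
  · rintro ⟨v, hv, rfl⟩
    exact ⟨v.2, hv⟩
  · rintro ⟨hm, h'⟩
    exact ⟨⟨m, hm⟩, h', rfl⟩

theorem le_card_part (hr : 0 < r) (i : Fin r) : n / r ≤ (part n r i).card := by
  rw [card_part hr]
  exact Nat.le_add_right _ _

theorem card_part_le (hr : 0 < r) (i : Fin r) : (part n r i).card ≤ n / r + 1 := by
  rw [card_part hr]
  split_ifs <;> omega

theorem exists_card_part_eq (n : ℕ) (hr : 0 < r) : ∃ i : Fin r, (part n r i).card = n / r := by
  -- The residue `r - 1` is never below `n % r`, so its class gets no extra vertex.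
  refine ⟨Fin.rev ⟨r - 1, by omega⟩, ?_⟩
  rw [card_part hr, Fin.rev_rev, if_neg, add_zero]
  have := Nat.mod_lt n hr
  simp only
  omega

theorem embedded_adj (hr : 0 < r) (G : SimpleGraph (Fin n)) (u v : Fin n) :
    (embedded r G).Adj u v ↔ G.Adj u v ∧ partIndex hr u = partIndex hr v := by
  simp only [embedded, iSup_adj, embeddedPart, mem_part_iff hr]
  constructor
  · rintro ⟨i, h, rfl, h'⟩
    exact ⟨h, h'.symm⟩
  · rintro ⟨h, h'⟩
    exact ⟨_, h, rfl, h'.symm⟩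

theorem embeddedPart_adj (hr : 0 < r) (G : SimpleGraph (Fin n)) (i : Fin r) (u v : Fin n) :
    (embeddedPart r G i).Adj u v ↔ (embedded r G).Adj u v ∧ partIndex hr u = i := by
  rw [embedded_adj hr]
  simp only [embeddedPart, mem_part_iff hr]
  constructor
  · rintro ⟨h, rfl, h'⟩
    exact ⟨⟨h, h'.symm⟩, rfl⟩
  · rintro ⟨⟨h, h'⟩, rfl⟩
    exact ⟨h, rfl, h'.symm⟩

/-- A walk along embedded edges never leaves the part in which it starts. -/
theorem walksFrom_embeddedPart (hr : 0 < r) (G : SimpleGraph (Fin n)) (l : ℕ) (u : Fin n) :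
    walksFrom (embeddedPart r G (partIndex hr u)) l u = walksFrom (embedded r G) l u := by
  classical
  induction l generalizing u with
  | zero => simp
  | succ l ih =>
    rw [walksFrom_succ, walksFrom_succ]
    refine Finset.sum_congr rfl fun v _ => ?_
    simp only [embeddedPart_adj hr, and_true]
    split_ifs with h
    · rw [((embedded_adj hr G u v).1 h).2, ih]
    · rfl

theorem W_embeddedPart (hr : 0 < r) (G : SimpleGraph (Fin n)) (l : ℕ) (i : Fin r) :
    W (l + 1) (embeddedPart r G i) =
      ∑ u with partIndex hr u = i, walksFrom (embedded r G) (l + 1) u := by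
  classical
  rw [W, Finset.sum_filter]
  refine Finset.sum_congr rfl fun u _ => ?_
  split_ifs with h
  · rw [← h, walksFrom_embeddedPart]
  · rw [walksFrom_succ]
    simp [embeddedPart_adj hr, h]

theorem sum_W_embeddedPart (hr : 0 < r) (G : SimpleGraph (Fin n)) (l : ℕ) :
    ∑ i, W (l + 1) (embeddedPart r G i) = W (l + 1) (embedded r G) := by
  simp_rw [W_embeddedPart hr]
  exact Finset.sum_fiberwise _ _ _

theorem W_embeddedPart_le (hr : 0 < r) (G : SimpleGraph (Fin n)) (l : ℕ) (i : Fin r) :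
    W (l + 1) (embeddedPart r G i) ≤ W (l + 1) (embedded r G) := by
  rw [← sum_W_embeddedPart hr]
  exact Finset.single_le_sum (f := fun i => W (l + 1) (embeddedPart r G i))
    (fun _ _ => Nat.zero_le _) (Finset.mem_univ i)

theorem W_one_embedded {G : SimpleGraph (Fin n)} (hG : G ∈ turanEmbed n r t) :
    W 1 (embedded r G) = 2 * t := by
  rw [W_one, hG.2]

/-- Walks of length zero contribute the size of the part; the longer ones stay inside it. -/
theorem sum_vertexSeries (hr : 0 < r) (G : SimpleGraph (Fin n)) {x : ℝ}
    (hx : (W 1 (embedded r G) : ℝ) < x) (i : Fin r) :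
    ∑ u with partIndex hr u = i, vertexSeries (embedded r G) x u =
      (part n r i).card + walkSeries (embeddedPart r G i) x := by
  have hs := fun u => summable_vertexSeries (embedded r G) hx u
  have h : ∀ u, vertexSeries (embedded r G) x u =
      1 + ∑' l : ℕ, (walksFrom (embedded r G) (l + 1) u : ℝ) * x⁻¹ ^ (l + 1) := by
    intro u
    rw [vertexSeries, (hs u).tsum_eq_zero_add]
    simp
  rw [Finset.sum_congr rfl fun u _ => h u, Finset.sum_add_distrib,
    ← Summable.tsum_finsetSum fun u _ => (summable_nat_add_iff 1).2 (hs u)]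
  congr 1
  · rw [part_eq_filter hr]
    simp
  · refine tsum_congr fun l => ?_
    rw [W_embeddedPart hr, Nat.cast_sum, Finset.sum_mul]

/-- The left-hand side of the equation that determines the spectral radius of `G`. -/
def turanSum (r : ℕ) (G : SimpleGraph (Fin n)) (x : ℝ) : ℝ :=
  ∑ i : Fin r, x / (x + ((part n r i).card + walkSeries (embeddedPart r G i) x))

theorem rho_eq_of_turanSum_eq (hr : 0 < r) (hn : 0 < n) {G : SimpleGraph (Fin n)}
    (hG : G ∈ turanEmbed n r t) {x : ℝ} (hx : 2 * (t : ℝ) < x) (h : turanSum r G x = r - 1) :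
    rho G = ENNReal.ofReal x := by
  have : Nonempty (Fin n) := ⟨⟨0, hn⟩⟩
  have hx' : (W 1 (embedded r G) : ℝ) < x := by
    rw [W_one_embedded hG]
    exact_mod_cast hx
  refine rho_eq_of_sum_eq (partIndex hr) (H := embedded r G) (fun u v => ?_) (fun u v huv => ?_)
    hx' ?_
  · rw [embedded_adj hr]
    by_cases hc : partIndex hr u = partIndex hr v
    · simp [hc]
    · have : G.Adj u v := hG.1 (by rwa [turanGraph_adj, ne_eq, ← partIndex_eq_iff hr])
      simp [hc, this]
  · exact ((embedded_adj hr G u v).1 huv).2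
  · rw [← h, turanSum]
    exact Finset.sum_congr rfl fun i _ => by rw [sum_vertexSeries hr G hx']

theorem continuousOn_turanSum (hr : 0 < r) {G : SimpleGraph (Fin n)}
    (hG : G ∈ turanEmbed n r t) {a : ℝ} (ha : 2 * (t : ℝ) < a) :
    ContinuousOn (turanSum r G) (Set.Ici a) := by
  have ha0 : 0 < a := lt_of_le_of_lt (by positivity) ha
  refine continuousOn_finsetSum _ fun i _ => ?_
  have h1 : (W 1 (embeddedPart r G i) : ℝ) < a := by
    refine lt_of_le_of_lt ?_ ha
    have := (W_embeddedPart_le hr G 0 i).trans_eq (W_one_embedded hG)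
    exact_mod_cast this
  refine continuousOn_id.div (continuousOn_id.add (continuousOn_const.add
    (continuousOn_walkSeries _ h1))) fun x hx => ?_
  have hx0 : 0 < x := ha0.trans_le hx
  have := walkSeries_nonneg (embeddedPart r G i) hx0.le
  positivity

theorem walkSeries_embeddedPart_le (hr : 0 < r) (ht : 1 ≤ t) {G : SimpleGraph (Fin n)}
    (hG : G ∈ turanEmbed n r t) (i : Fin r) {x : ℝ} (hx : 4 * (t : ℝ) ≤ x) (m : ℕ) :
    walkSeries (embeddedPart r G i) x ≤
      ∑ l ∈ Finset.range m, (W (l + 1) (embeddedPart r G i) : ℝ) * x⁻¹ ^ (l + 1)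
        + 2 * (2 * t / x) ^ (m + 1) := by
  have h := walkSeries_le_sum_add (embeddedPart r G i) (k := 2 * t)
    ((W_embeddedPart_le hr G 0 i).trans_eq (W_one_embedded hG)) (by omega) (x := x)
    (by push_cast; linarith) m
  simpa using h

/-- Lower end of the bracket for the root: each of the `r` terms is at most `(r - 1) / r`. -/
theorem turanSum_le (hr : 0 < r) (G : SimpleGraph (Fin n)) {x : ℝ} (hx : 0 < x)
    (hx' : x ≤ (r - 1) * (n / r : ℕ)) : turanSum r G x ≤ r - 1 := by
  have hr' : (0 : ℝ) < r := by exact_mod_cast hr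
  have h : ∀ i : Fin r,
      x / (x + ((part n r i).card + walkSeries (embeddedPart r G i) x)) ≤ (r - 1) / r := by
    intro i
    have h1 := walkSeries_nonneg (embeddedPart r G i) hx.le
    have h2 : ((n / r : ℕ) : ℝ) ≤ (part n r i).card := by exact_mod_cast le_card_part hr i
    have h3 : (1 : ℝ) ≤ r := by exact_mod_cast hr
    rw [div_le_div_iff₀ (by positivity) hr']
    nlinarith
  refine (Finset.sum_le_sum fun i _ => h i).trans ?_
  rw [Finset.sum_const, Finset.card_univ, Fintype.card_fin, nsmul_eq_mul]
  field_simp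
  exact le_rfl

/-- Upper end of the bracket: for `x ≥ 4t` each walk series is at most 1, so the denominators are at
most `x + n / r + 2`. -/
theorem le_turanSum (hr : 0 < r) (ht : 1 ≤ t) {G : SimpleGraph (Fin n)}
    (hG : G ∈ turanEmbed n r t) {x : ℝ} (hx : 4 * (t : ℝ) ≤ x)
    (hx' : (r - 1) * ((n / r : ℕ) + 2) ≤ x) : r - 1 ≤ turanSum r G x := by
  have hr' : (0 : ℝ) < r := by exact_mod_cast hr
  have ht' : (1 : ℝ) ≤ t := by exact_mod_cast ht
  have hx0 : 0 < x := by linarith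
  have h : ∀ i : Fin r, ((r : ℝ) - 1) / r ≤
      x / (x + ((part n r i).card + walkSeries (embeddedPart r G i) x)) := by
    intro i
    have h1 := walkSeries_nonneg (embeddedPart r G i) hx0.le
    have h2 : ((part n r i).card : ℝ) ≤ (n / r : ℕ) + 1 := by exact_mod_cast card_part_le hr i
    have h3 : walkSeries (embeddedPart r G i) x ≤ 1 := by
      refine (walkSeries_embeddedPart_le hr ht hG i hx 0).trans ?_
      have : 2 * (t : ℝ) / x ≤ 1 / 2 := by
        rw [div_le_iff₀ hx0]
        linarith
      simp only [Finset.range_zero, Finset.sum_empty, zero_add, pow_one]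
      linarith
    have h4 : (1 : ℝ) ≤ r := by exact_mod_cast hr
    rw [div_le_div_iff₀ hr' (by positivity)]
    nlinarith
  refine le_trans ?_ (Finset.sum_le_sum fun i _ => h i)
  rw [Finset.sum_const, Finset.card_univ, Fintype.card_fin, nsmul_eq_mul]
  field_simp
  exact le_rfl

theorem exists_turanSum_eq (hr : 2 ≤ r) (ht : 1 ≤ t) {G : SimpleGraph (Fin n)}
    (hG : G ∈ turanEmbed n r t) {a : ℝ} (ha : 4 * (t : ℝ) ≤ a)
    (h : turanSum r G a ≤ r - 1) : ∃ x, a ≤ x ∧ turanSum r G x = r - 1 := by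
  have ht' : (1 : ℝ) ≤ t := by exact_mod_cast ht
  set b : ℝ := max a ((r - 1) * ((n / r : ℕ) + 2)) with hb
  have hab : a ≤ b := le_max_left _ _
  have hc : ContinuousOn (turanSum r G) (Set.Icc a b) :=
    (continuousOn_turanSum (by omega) hG (by linarith)).mono Set.Icc_subset_Ici_self
  obtain ⟨x, hx, hx'⟩ := intermediate_value_Icc hab hc
    ⟨h, le_turanSum (by omega) ht hG (ha.trans hab) (le_max_right _ _)⟩
  exact ⟨x, hx.1, hx'⟩

theorem exists_rho_eq (hr : 2 ≤ r) (ht : 1 ≤ t) (hn : 4 * t ≤ n / r) {G : SimpleGraph (Fin n)}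
    (hG : G ∈ turanEmbed n r t) :
    ∃ x : ℝ, ((n / r : ℕ) : ℝ) ≤ x ∧ turanSum r G x = r - 1 := by
  have hr' : (2 : ℝ) ≤ r := by exact_mod_cast hr
  have ht' : (1 : ℝ) ≤ t := by exact_mod_cast ht
  have hn' : 4 * (t : ℝ) ≤ (n / r : ℕ) := by exact_mod_cast hn
  have h1 : ((n / r : ℕ) : ℝ) ≤ (r - 1) * (n / r : ℕ) := by nlinarith
  obtain ⟨x, hx, hx'⟩ := exists_turanSum_eq hr ht hG (a := (r - 1) * (n / r : ℕ)) (by linarith)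
    (turanSum_le (by omega) G (by linarith) le_rfl)
  exact ⟨x, h1.trans hx, hx'⟩

/-- At the root for `G'` the sum for `G` is still below `r - 1`, so `G` has a root further to the
right. Monotonicity of the sums is not needed, since any root in this range is the spectral radius.
-/
theorem rho_lt_of_turanSum_lt (hr : 2 ≤ r) (ht : 1 ≤ t) (hn : 4 * t ≤ n / r)
    {G G' : SimpleGraph (Fin n)} (hG : G ∈ turanEmbed n r t) (hG' : G' ∈ turanEmbed n r t)
    (h : ∀ x : ℝ, ((n / r : ℕ) : ℝ) ≤ x → turanSum r G x < turanSum r G' x) :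
    rho G' < rho G := by
  have ht' : (1 : ℝ) ≤ t := by exact_mod_cast ht
  have hn' : 4 * (t : ℝ) ≤ (n / r : ℕ) := by exact_mod_cast hn
  have hn0 : 0 < n := Nat.pos_of_ne_zero fun h0 => by
    rw [h0, Nat.zero_div] at hn
    omega
  obtain ⟨x, hx, hx'⟩ := exists_rho_eq hr ht hn hG'
  have hlt := (h x hx).trans_eq hx'
  obtain ⟨y, hy, hy'⟩ := exists_turanSum_eq hr ht hG (by linarith) hlt.le
  have hxy : x < y := lt_of_le_of_ne hy fun he => by
    rw [he, hy'] at hlt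
    exact lt_irrefl _ hlt
  rw [rho_eq_of_turanSum_eq (by omega) hn0 hG' (by linarith) hx',
    rho_eq_of_turanSum_eq (by omega) hn0 hG (by linarith) hy']
  exact (ENNReal.ofReal_lt_ofReal_iff (by linarith)).2 hxy

theorem rho_eq_of_turanSum_eq_turanSum (hr : 2 ≤ r) (ht : 1 ≤ t) (hn : 4 * t ≤ n / r)
    {G G' : SimpleGraph (Fin n)} (hG : G ∈ turanEmbed n r t) (hG' : G' ∈ turanEmbed n r t)
    (h : turanSum r G = turanSum r G') : rho G' = rho G := by
  have ht' : (1 : ℝ) ≤ t := by exact_mod_cast ht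
  have hn' : 4 * (t : ℝ) ≤ (n / r : ℕ) := by exact_mod_cast hn
  have hn0 : 0 < n := Nat.pos_of_ne_zero fun h0 => by
    rw [h0, Nat.zero_div] at hn
    omega
  obtain ⟨x, hx, hx'⟩ := exists_rho_eq hr ht hn hG'
  rw [rho_eq_of_turanSum_eq (by omega) hn0 hG' (by linarith) hx',
    rho_eq_of_turanSum_eq (x := x) (by omega) hn0 hG (by linarith) (by rw [h, hx'])]

theorem embeddedPart_eq_bot (hr : 0 < r) {G : SimpleGraph (Fin n)} {i j : Fin r}
    (h : embedded r G = embeddedPart r G i) (hij : j ≠ i) : embeddedPart r G j = ⊥ := by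
  ext u v
  rw [embeddedPart_adj hr, h, embeddedPart_adj hr, bot_adj]
  constructor
  · rintro ⟨⟨-, rfl⟩, rfl⟩
    exact hij rfl
  · exact False.elim

/-- If all embedded edges lie in one part, then `turanSum` differs in one term from the sum for the
Turán graph. -/
theorem turanSum_of_embedded_eq (hr : 0 < r) {G : SimpleGraph (Fin n)} {i : Fin r}
    (h : embedded r G = embeddedPart r G i) (x : ℝ) :
    turanSum r G x = ∑ j : Fin r, x / (x + (part n r j).card) - x / (x + (part n r i).card)
      + x / (x + (part n r i).card + walkSeries (embedded r G) x) := by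
  rw [turanSum, ← Finset.add_sum_erase _ _ (Finset.mem_univ i),
    ← Finset.add_sum_erase _ (fun j => x / (x + ((part n r j).card : ℝ))) (Finset.mem_univ i),
    h, add_sub_cancel_left, add_comm, add_assoc x]
  congr 1
  refine Finset.sum_congr rfl fun j hj => ?_
  rw [embeddedPart_eq_bot hr h (Finset.ne_of_mem_erase hj), walkSeries_bot]
  simp

end Turan

/-! ### Walk-preferable graphs -/

section Lex

variable {V : Type} [Fintype V] {V' : Type} [Fintype V']

/-- The numbers of walks of positive length of `H'` are lexicographically smaller than those of
`H`. -/
def WalkLt (H' : SimpleGraph V') (H : SimpleGraph V) : Prop :=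
  ∃ l, (∀ m < l, W (m + 1) H' = W (m + 1) H) ∧ W (l + 1) H' < W (l + 1) H

theorem W_eq_or_walkLt {H' : SimpleGraph V'} {H : SimpleGraph V} (h : ¬ WalkLt H H') :
    (∀ l, W (l + 1) H' = W (l + 1) H) ∨ WalkLt H' H := by
  classical
  by_cases hall : ∀ l, W (l + 1) H' = W (l + 1) H
  · exact Or.inl hall
  · push Not at hall
    refine Or.inr ⟨Nat.find hall, fun m hm => not_not.1 (Nat.find_min hall hm), ?_⟩
    refine lt_of_le_of_ne (not_lt.1 fun hlt => h ⟨Nat.find hall, fun m hm => ?_, hlt⟩)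
      (Nat.find_spec hall)
    exact (not_not.1 (Nat.find_min hall hm)).symm

theorem EX_subset (𝒜 : Set (SimpleGraph V)) (l : ℕ) : EX l 𝒜 ⊆ 𝒜 := by
  induction l with
  | zero => exact subset_rfl
  | succ l ih => exact fun H hH => ih hH.1

theorem EX_W_eq {𝒜 : Set (SimpleGraph V)} {H H' : SimpleGraph V} {l : ℕ} (hH : H ∈ EX l 𝒜)
    (hH' : H' ∈ EX l 𝒜) : ∀ m < l, W (m + 1) H = W (m + 1) H' := by
  induction l with
  | zero => intro m hm; omega
  | succ l ih =>
    intro m hm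
    rcases Nat.lt_succ_iff_lt_or_eq.1 hm with hm | rfl
    · exact ih hH.1 hH'.1 m hm
    · exact le_antisymm (hH'.2 H hH.1) (hH.2 H' hH'.1)

/-- Successive maximization is lexicographic maximization: members of `EX l 𝒜` share their first `l`
counts, and a graph of `𝒜` sharing these with a survivor survives too. -/
theorem mem_EXinf_iff {𝒜 : Set (SimpleGraph V)} {H : SimpleGraph V} (hH : H ∈ 𝒜) :
    H ∈ EXinf 𝒜 ↔ ∀ H' ∈ 𝒜, ¬ WalkLt H H' := by
  constructor
  · rintro h H' hH' ⟨l, hl, hlt⟩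
    have key : ∀ m ≤ l, H' ∈ EX m 𝒜 := by
      intro m
      induction m with
      | zero => exact fun _ => hH'
      | succ m ih =>
        intro hm
        refine ⟨ih (by omega), fun K hK => ?_⟩
        rw [← hl m (by omega)]
        exact (h (m + 1) (by omega)).2 K hK
    exact absurd ((h (l + 1) (by omega)).2 H' (key l le_rfl)) (not_le.2 hlt)
  · intro h l _
    induction l with
    | zero => exact hH
    | succ l ih =>
      have hl : H ∈ EX l 𝒜 := by
        rcases Nat.eq_zero_or_pos l with rfl | hl
        · exact hH
        · exact ih hl
      refine ⟨hl, fun H' hH' => not_lt.1 fun hlt => ?_⟩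
      exact h H' (EX_subset _ _ hH') ⟨l, EX_W_eq hl hH', hlt⟩

/-- At the first differing coefficient the integer gap gives at least `x⁻¹ ^ (l + 1)`, while the
remaining tail of `H'` is at most `2 * (k / x) ^ (l + 2)`; the bound on `x` makes the gap win. -/
theorem walkSeries_lt {H' : SimpleGraph V'} {H : SimpleGraph V} {k : ℕ} (hk : 1 ≤ k)
    (hH : W 1 H ≤ k) (hH' : W 1 H' ≤ k) {l : ℕ} (heq : ∀ m < l, W (m + 1) H' = W (m + 1) H)
    (hlt : W (l + 1) H' < W (l + 1) H) {x : ℝ} (hx : 2 * (k : ℝ) ^ (l + 2) < x) :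
    walkSeries H' x < walkSeries H x := by
  have hk' : (1 : ℝ) ≤ k := by exact_mod_cast hk
  have hkx : 2 * (k : ℝ) < x := by
    refine lt_of_le_of_lt ?_ hx
    have := le_self_pow₀ hk' (n := l + 2) (by omega)
    linarith
  have hx0 : 0 < x := by linarith
  have h1 := walkSeries_le_sum_add H' hH' hk hkx.le (l + 1)
  have hH1 : (W 1 H : ℝ) ≤ k := by exact_mod_cast hH
  have h2 := sum_le_walkSeries H (x := x) (by linarith) (l + 1)
  have h3 : ∑ m ∈ Finset.range l, (W (m + 1) H' : ℝ) * x⁻¹ ^ (m + 1) =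
      ∑ m ∈ Finset.range l, (W (m + 1) H : ℝ) * x⁻¹ ^ (m + 1) :=
    Finset.sum_congr rfl fun m hm => by rw [heq m (Finset.mem_range.1 hm)]
  rw [Finset.sum_range_succ] at h1 h2
  have h4 : (W (l + 1) H' : ℝ) + 1 ≤ W (l + 1) H := by exact_mod_cast hlt
  have h5 : ((W (l + 1) H' : ℝ) + 1) * x⁻¹ ^ (l + 1) ≤ W (l + 1) H * x⁻¹ ^ (l + 1) := by gcongr
  have h6 : 2 * ((k : ℝ) / x) ^ (l + 1 + 1) < x⁻¹ ^ (l + 1) := by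
    rw [div_pow, inv_pow, pow_succ x, ← mul_div_assoc, inv_eq_one_div,
      div_lt_div_iff₀ (by positivity) (by positivity)]
    have : 0 < x ^ (l + 1) := by positivity
    nlinarith
  linarith

/-- Since up to isolated vertices there are finitely many graphs with a given number of edges,
one bound works for all of them. -/
theorem exists_forall_walkSeries_lt (k : ℕ) (hk : 1 ≤ k) :
    ∃ X : ℝ, ∀ x, X ≤ x → ∀ (V : Type) [Fintype V] (H H' : SimpleGraph V), W 1 H ≤ k →
      W 1 H' ≤ k → WalkLt H' H → walkSeries H' x < walkSeries H x := by
  have key : ∀ᶠ x : ℝ in Filter.atTop, ∀ K K' : SimpleGraph (Fin k), W 1 K ≤ k → W 1 K' ≤ k →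
      WalkLt K' K → walkSeries K' x < walkSeries K x := by
    refine Filter.eventually_all.2 fun K => Filter.eventually_all.2 fun K' => ?_
    by_cases h : WalkLt K' K
    · obtain ⟨l, heq, hlt⟩ := h
      filter_upwards [Filter.eventually_gt_atTop (2 * (k : ℝ) ^ (l + 2))] with x hx hK hK' _
      exact walkSeries_lt hk hK hK' heq hlt hx
    · exact Filter.Eventually.of_forall fun x _ _ h' => absurd h' h
  obtain ⟨X, hX⟩ := Filter.eventually_atTop.1 key
  refine ⟨X, fun x hx V _ H H' hH hH' hlt => ?_⟩
  obtain ⟨K, hK⟩ := exists_fin_W_eq H hH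
  obtain ⟨K', hK'⟩ := exists_fin_W_eq H' hH'
  rw [← walkSeries_congr hK, ← walkSeries_congr hK']
  refine hX x hx K K' (by rwa [hK]) (by rwa [hK']) ?_
  simpa only [WalkLt, hK, hK'] using hlt

end Lex

/-! ### Comparison of the spectral radii -/

section Comparison

variable {n r t : ℕ}

/-- With the part fixed, the sums differ in a single term, strictly decreasing in the walk series;
hence spectral order is lexicographic order of walk counts. -/
theorem mem_SPEX_inPart_iff (t r : ℕ) (ht : 1 ≤ t) (hr : 2 ≤ r) :
    ∃ Q : ℕ, ∀ n : ℕ, Q ≤ n / r → ∀ 𝒢 : Set (SimpleGraph (Fin n)), 𝒢 ⊆ turanEmbed n r t →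
      ∀ i : Fin r, ∀ G ∈ inPart 𝒢 i,
        (G ∈ SPEX (inPart 𝒢 i) ↔ embedded r G ∈ EXinf (embeddedSet r (inPart 𝒢 i))) := by
  obtain ⟨X, hX⟩ := exists_forall_walkSeries_lt (2 * t) (by omega)
  refine ⟨max (4 * t) ⌈X⌉₊, fun n hn 𝒢 h𝒢 i G hG => ?_⟩
  have hn1 : 4 * t ≤ n / r := (le_max_left _ _).trans hn
  have hn2 : X ≤ (n / r : ℕ) :=
    (Nat.le_ceil X).trans (by exact_mod_cast (le_max_right _ _).trans hn)
  have hW : ∀ G ∈ inPart 𝒢 i, W 1 (embedded r G) ≤ 2 * t := fun G hG =>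
    (W_one_embedded (h𝒢 hG.1)).le
  have hlt : ∀ G ∈ inPart 𝒢 i, ∀ G' ∈ inPart 𝒢 i, WalkLt (embedded r G') (embedded r G) →
      rho G' < rho G := by
    intro G hG G' hG' h
    refine rho_lt_of_turanSum_lt hr ht hn1 (h𝒢 hG.1) (h𝒢 hG'.1) fun x hx => ?_
    have hx0 : 0 < x := lt_of_lt_of_le (by exact_mod_cast (by omega : 0 < n / r)) hx
    rw [turanSum_of_embedded_eq (by omega) hG.2, turanSum_of_embedded_eq (by omega) hG'.2]
    have h1 := hX x (hn2.trans hx) _ _ _ (hW G hG) (hW G' hG') h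
    have h2 := walkSeries_nonneg (embedded r G') hx0.le
    gcongr
  have hmem : embedded r G ∈ embeddedSet r (inPart 𝒢 i) := ⟨G, hG, rfl⟩
  rw [mem_EXinf_iff hmem]
  constructor
  · rintro h _ ⟨G', hG', rfl⟩ hwl
    exact absurd (h.2 G' hG') (not_le.2 (hlt G' hG' G hG hwl))
  · intro h
    refine ⟨hG, fun G' hG' => ?_⟩
    rcases W_eq_or_walkLt (h _ ⟨G', hG', rfl⟩) with heq | hwl
    · refine (rho_eq_of_turanSum_eq_turanSum hr ht hn1 (h𝒢 hG.1) (h𝒢 hG'.1) ?_).le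
      funext x
      rw [turanSum_of_embedded_eq (by omega) hG.2, turanSum_of_embedded_eq (by omega) hG'.2,
        walkSeries_congr heq]
    · exact (hlt G hG G' hG' hwl).le

theorem rho_eq_of_isCopy (hr : 2 ≤ r) (ht : 1 ≤ t) (hn : 4 * t ≤ n / r)
    {G G' : SimpleGraph (Fin n)} (hG : G ∈ turanEmbed n r t) (hG' : G' ∈ turanEmbed n r t)
    {i j : Fin r} (hi : embedded r G = embeddedPart r G i)
    (hj : embedded r G' = embeddedPart r G' j) (hij : (part n r i).card = (part n r j).card)
    (h : IsCopy (embedded r G') (embedded r G)) : rho G' = rho G := by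
  refine rho_eq_of_turanSum_eq_turanSum hr ht hn hG hG' ?_
  funext x
  rw [turanSum_of_embedded_eq (by omega) hi, turanSum_of_embedded_eq (by omega) hj, hij,
    walkSeries_congr h.W_eq]

/-- The amount by which a walk series `g` lowers a term of the sum. -/
theorem div_sub_div_add {a g : ℝ} (x : ℝ) (ha : 0 < a) (hg : 0 ≤ g) :
    x / a - x / (a + g) = x * (g / (a * (a + g))) := by
  have : 0 < a + g := by linarith
  field_simp
  ring

/-- Embedding edges with more walks of length two into a part of size `⌊n/r⌋` is better. -/
theorem turanSum_lt_of_W_two_lt (hr : 2 ≤ r) (ht : 1 ≤ t) {G₀ G : SimpleGraph (Fin n)}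
    (hG₀ : G₀ ∈ turanEmbed n r t) (hG : G ∈ turanEmbed n r t) {j : Fin r}
    (hj : embedded r G₀ = embeddedPart r G₀ j) (hjc : (part n r j).card = n / r)
    (hW : W 2 (embedded r G) < W 2 (embedded r G₀)) {x : ℝ}
    (hxt : 4 * (t : ℝ) ≤ x) (hxC : (4 * t * r : ℝ) ^ 2 + 2 * r * (2 * t) ^ 3 < x) :
    turanSum r G₀ x < turanSum r G x := by
  have hr' : (2 : ℝ) ≤ r := by exact_mod_cast hr
  have ht' : (1 : ℝ) ≤ t := by exact_mod_cast ht
  have hx0 : 0 < x := by linarith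
  set q : ℝ := ((n / r : ℕ) : ℝ) with hq
  have hq0 : 0 ≤ q := Nat.cast_nonneg _
  set y : ℝ := x + q with hy
  have hy0 : 0 < y := by linarith
  set g₀ := walkSeries (embedded r G₀) x with hg₀
  set g : Fin r → ℝ := fun i => walkSeries (embeddedPart r G i) x with hg
  set s := ∑ i, g i with hs
  have hg0 : ∀ i, 0 ≤ g i := fun i => walkSeries_nonneg _ hx0.le
  have hs0 : 0 ≤ s := Finset.sum_nonneg fun i _ => hg0 i
  have hg₀0 : 0 ≤ g₀ := walkSeries_nonneg _ hx0.le
  have hlow : 2 * t / x + W 2 (embedded r G₀) / x ^ 2 ≤ g₀ := by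
    have h := sum_le_walkSeries (embedded r G₀) (x := x)
      (by rw [W_one_embedded hG₀]; push_cast; linarith) 2
    simp only [Finset.sum_range_succ, Finset.sum_range_zero, zero_add, W_one_embedded hG₀] at h
    refine le_trans (le_of_eq ?_) h
    push_cast
    rw [pow_one, inv_pow]
    rfl
  have hupp : s ≤ 2 * t / x + W 2 (embedded r G) / x ^ 2 + 2 * r * (2 * t) ^ 3 / x ^ 3 := by
    have h1 : ((2 * t : ℕ) : ℝ) = ∑ i, (W 1 (embeddedPart r G i) : ℝ) := by
      rw [← W_one_embedded hG]
      exact_mod_cast (sum_W_embeddedPart (by omega) G 0).symm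
    have h2 : (W 2 (embedded r G) : ℝ) = ∑ i, (W 2 (embeddedPart r G i) : ℝ) := by
      exact_mod_cast (sum_W_embeddedPart (by omega) G 1).symm
    calc s ≤ ∑ i, ((W 1 (embeddedPart r G i) : ℝ) * x⁻¹ + W 2 (embeddedPart r G i) * (x ^ 2)⁻¹
          + 2 * (2 * t / x) ^ 3) := by
          refine Finset.sum_le_sum fun i _ => ?_
          refine (walkSeries_embeddedPart_le (by omega) ht hG i hxt 2).trans (le_of_eq ?_)
          simp [Finset.sum_range_succ]
      _ = _ := by
          rw [Finset.sum_add_distrib, Finset.sum_add_distrib, ← Finset.sum_mul, ← Finset.sum_mul,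
            ← h1, ← h2, Finset.sum_const, Finset.card_univ, Fintype.card_fin, nsmul_eq_mul]
          push_cast
          rw [div_pow]
          ring
  -- These crude bounds on `s` and `g₀` serve only for the second-order product `s * g₀`; their
  -- square gives the first summand of the threshold `hxC`.
  have hsE : s ≤ 4 * t * r / x := by
    calc s ≤ ∑ _i : Fin r, 2 * (2 * t / x) := by
          refine Finset.sum_le_sum fun i _ => ?_
          refine (walkSeries_embeddedPart_le (by omega) ht hG i hxt 0).trans (le_of_eq ?_)
          simp
      _ = _ := by
          rw [Finset.sum_const, Finset.card_univ, Fintype.card_fin, nsmul_eq_mul]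
          ring
  have hg₀E : g₀ ≤ 4 * t * r / x := by
    have h := walkSeries_embeddedPart_le (by omega) ht hG₀ j hxt 0
    rw [← hj] at h
    refine h.trans ?_
    simp only [Finset.range_zero, Finset.sum_empty, zero_add, pow_one]
    rw [← mul_div_assoc]
    refine div_le_div_of_nonneg_right ?_ hx0.le
    nlinarith
  have hW' : (W 2 (embedded r G) : ℝ) + 1 ≤ W 2 (embedded r G₀) := by exact_mod_cast hW
  have hdiff : 1 / x ^ 2 - 2 * r * (2 * t) ^ 3 / x ^ 3 ≤ g₀ - s := by
    have : ((W 2 (embedded r G) : ℝ) + 1) / x ^ 2 ≤ W 2 (embedded r G₀) / x ^ 2 := by gcongr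
    rw [add_div] at this
    linarith
  -- This is `s / y ^ 2 < g₀ / (y * (y + g₀))` with denominators cleared.
  have hkey : s * g₀ < (g₀ - s) * y := by
    have h1 : s * g₀ ≤ (4 * t * r / x) * (4 * t * r / x) :=
      mul_le_mul hsE hg₀E hg₀0 (by positivity)
    have h2 : (4 * t * r / x) * (4 * t * r / x) < (1 / x ^ 2 - 2 * r * (2 * t) ^ 3 / x ^ 3) * x := by
      have e1 : (1 / x ^ 2 - 2 * r * (2 * t) ^ 3 / x ^ 3) * x
          - (4 * t * r / x) * (4 * t * r / x)
          = (x - ((4 * t * r : ℝ) ^ 2 + 2 * r * (2 * t) ^ 3)) / x ^ 2 := by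
        field_simp
        ring
      have e2 : 0 < (x - ((4 * t * r : ℝ) ^ 2 + 2 * r * (2 * t) ^ 3)) / x ^ 2 :=
        div_pos (by linarith) (by positivity)
      linarith
    have h3 : 0 ≤ g₀ - s := by
      refine le_trans ?_ hdiff
      by_contra! hneg
      nlinarith [mul_neg_of_neg_of_pos hneg hx0, mul_self_nonneg (4 * t * r / x)]
    calc s * g₀ < (1 / x ^ 2 - 2 * r * (2 * t) ^ 3 / x ^ 3) * x := h1.trans_lt h2
      _ ≤ (g₀ - s) * x := by gcongr
      _ ≤ (g₀ - s) * y := by gcongr; linarith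
  -- Replacing each part size by `q` and dropping `g i` from the denominator overestimates the loss,
  -- and leaves a bound in the total `s` alone, however the edges are distributed.
  have hG_le : ∑ i : Fin r, x / (x + (part n r i).card) - x * (s / y ^ 2) ≤ turanSum r G x := by
    rw [hs, Finset.sum_div, Finset.mul_sum, ← Finset.sum_sub_distrib, turanSum]
    refine Finset.sum_le_sum fun i _ => ?_
    have hn : q ≤ (part n r i).card := Nat.cast_le.2 (le_card_part (by omega) i)
    have hpos : 0 < x + ((part n r i).card : ℝ) := by linarith
    rw [← add_assoc, sub_le_comm, div_sub_div_add x hpos (hg0 i)]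
    refine mul_le_mul_of_nonneg_left ?_ hx0.le
    have := hg0 i
    refine div_le_div_of_nonneg_left this (by positivity) ?_
    rw [sq]
    refine mul_le_mul ?_ ?_ hy0.le hpos.le <;> simp only [hy] <;> linarith
  refine lt_of_lt_of_le ?_ hG_le
  rw [turanSum_of_embedded_eq (by omega) hj, hjc, ← hq, ← hy, ← hg₀]
  have h := div_sub_div_add x hy0 hg₀0
  have h' : x * (s / y ^ 2) < x * (g₀ / (y * (y + g₀))) := by
    refine mul_lt_mul_of_pos_left ?_ hx0
    rw [div_lt_div_iff₀ (by positivity) (by positivity)]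
    nlinarith
  linarith

/-- With the same number of walks of length two, a part of size `⌊n/r⌋` is better than a larger
one. -/
theorem turanSum_lt_of_card_part (hr : 2 ≤ r) (ht : 1 ≤ t) {G₀ G : SimpleGraph (Fin n)}
    (hG₀ : G₀ ∈ turanEmbed n r t) (hG : G ∈ turanEmbed n r t) {i j : Fin r}
    (hi : embedded r G = embeddedPart r G i) (hic : (part n r i).card = n / r + 1)
    (hj : embedded r G₀ = embeddedPart r G₀ j) (hjc : (part n r j).card = n / r)
    (hW : W 2 (embedded r G) = W 2 (embedded r G₀)) {x : ℝ} (hx : ((n / r : ℕ) : ℝ) ≤ x)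
    (hxt : 4 * (t : ℝ) ≤ x) (hxC : (2 * (2 * t) ^ 3 : ℝ) < x) :
    turanSum r G₀ x < turanSum r G x := by
  have ht' : (1 : ℝ) ≤ t := by exact_mod_cast ht
  have hx0 : 0 < x := by linarith
  set q : ℝ := ((n / r : ℕ) : ℝ) with hq
  have hq0 : 0 ≤ q := Nat.cast_nonneg _
  set y : ℝ := x + q with hy
  have hy0 : 0 < y := by linarith
  set g₀ := walkSeries (embedded r G₀) x with hg₀
  set g := walkSeries (embedded r G) x with hg
  have hg0 : 0 ≤ g := walkSeries_nonneg _ hx0.le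
  have hg₀0 : 0 ≤ g₀ := walkSeries_nonneg _ hx0.le
  have hlow : 2 * t / x + W 2 (embedded r G₀) / x ^ 2 ≤ g₀ := by
    have h := sum_le_walkSeries (embedded r G₀) (x := x)
      (by rw [W_one_embedded hG₀]; push_cast; linarith) 2
    simp only [Finset.sum_range_succ, Finset.sum_range_zero, zero_add, W_one_embedded hG₀] at h
    refine le_trans (le_of_eq ?_) h
    push_cast
    rw [pow_one, inv_pow]
    rfl
  have hupp : g ≤ 2 * t / x + W 2 (embedded r G) / x ^ 2 + 2 * (2 * t) ^ 3 / x ^ 3 := by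
    have h := walkSeries_embeddedPart_le (by omega) ht hG i hxt 2
    rw [← hi] at h
    simp only [Finset.sum_range_succ, Finset.sum_range_zero, zero_add, W_one_embedded hG] at h
    refine h.trans (le_of_eq ?_)
    push_cast
    rw [pow_one, inv_pow, div_pow, ← mul_div_assoc]
    rfl
  have hg₀low : 2 / x ≤ g₀ := by
    refine le_trans ?_ hlow
    have h1 : 2 / x ≤ 2 * t / x := by gcongr; linarith
    have h2 : 0 ≤ (W 2 (embedded r G₀) : ℝ) / x ^ 2 := by positivity
    linarith
  have hdiff : g - g₀ ≤ 2 * (2 * t) ^ 3 / x ^ 3 := by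
    rw [hW] at hupp
    linarith
  -- Here `y ≤ 2 * x`, so the left side is `O(x⁻²)`, while `g₀ ≥ 2 / x`.
  have hkey : y * (g - g₀) < 2 * g₀ := by
    have h1 : y * (g - g₀) ≤ y * (2 * (2 * t) ^ 3 / x ^ 3) := by gcongr
    have h2 : y * (2 * (2 * t) ^ 3 / x ^ 3) ≤ (2 * x) * (2 * (2 * t) ^ 3 / x ^ 3) := by
      gcongr
      linarith
    have h3 : (2 * x) * (2 * (2 * t) ^ 3 / x ^ 3) < 2 * (2 / x) := by
      have e1 : 2 * (2 / x) - (2 * x) * (2 * (2 * t) ^ 3 / x ^ 3) =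
          (2 * (2 * x - (2 * (2 * t) ^ 3))) / x ^ 2 := by
        field_simp
      have e2 : 0 < (2 * (2 * x - (2 * (2 * t : ℝ) ^ 3))) / x ^ 2 :=
        div_pos (by linarith) (by positivity)
      linarith
    linarith
  have hg₀pos : 0 < g₀ := lt_of_lt_of_le (by positivity) hg₀low
  rw [turanSum_of_embedded_eq (by omega) hj, turanSum_of_embedded_eq (by omega) hi, hic, hjc,
    Nat.cast_add, Nat.cast_one, ← hq, ← add_assoc x, ← hy, ← hg₀, ← hg]
  have h1 := div_sub_div_add x hy0 hg₀0
  have h2 := div_sub_div_add x (by linarith : 0 < y + 1) hg0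
  have h3 : x * (g / ((y + 1) * (y + 1 + g))) < x * (g₀ / (y * (y + g₀))) := by
    refine mul_lt_mul_of_pos_left ?_ hx0
    rw [div_lt_div_iff₀ (by positivity) (by positivity)]
    -- The gain `2 * g₀` comes from expanding `(y + 1) ^ 2`, that is, from the one extra vertex of
    -- the larger part.
    have e : g₀ * ((y + 1) * (y + 1 + g)) - g * (y * (y + g₀)) =
        y * (2 * g₀ - y * (g - g₀)) + g₀ + g₀ * g := by ring
    have e' : 0 < y * (2 * g₀ - y * (g - g₀)) := mul_pos hy0 (by linarith)
    have e'' : 0 ≤ g₀ * g := by positivity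
    linarith
  linarith

theorem SPEX_eq_iUnion_inPart (t r : ℕ) (ht : 1 ≤ t) (hr : 2 ≤ r) :
    ∃ Q : ℕ, ∀ n : ℕ, Q ≤ n / r → ∀ 𝒢 : Set (SimpleGraph (Fin n)), IsNormal n r t 𝒢 →
      {G | G ∈ 𝒢 ∧ embedded r G ∈ EX 2 (embeddedSet r 𝒢)} ⊆ ⋃ i : Fin r, inPart 𝒢 i →
      SPEX 𝒢 = ⋃ i ∈ {i : Fin r | (part n r i).card = n / r}, SPEX (inPart 𝒢 i) := by
  refine ⟨4 * t + (4 * t * r) ^ 2 + 2 * r * (2 * t) ^ 3 + 2 * (2 * t) ^ 3 + 1,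
    fun n hn 𝒢 hnormal hEX => ?_⟩
  have h𝒢 := hnormal.1
  have hQ : (4 * t + (4 * t * r) ^ 2 + 2 * r * (2 * t) ^ 3 + 2 * (2 * t) ^ 3 + 1 : ℝ)
      ≤ (n / r : ℕ) := by exact_mod_cast hn
  have hQ1 : (0 : ℝ) ≤ 4 * t := by positivity
  have hQ2 : (0 : ℝ) ≤ (4 * t * r) ^ 2 := by positivity
  have hQ3 : (0 : ℝ) ≤ 2 * r * (2 * t) ^ 3 := by positivity
  have hQ4 : (0 : ℝ) ≤ 2 * (2 * t) ^ 3 := by positivity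
  have hn1 : 4 * t ≤ n / r := by
    have : (4 * t : ℝ) ≤ (n / r : ℕ) := by linarith
    exact_mod_cast this
  have copy : ∀ i j : Fin r, ∀ G ∈ inPart 𝒢 i, ∃ G' ∈ inPart 𝒢 j,
      IsCopy (embedded r G') (embedded r G) := by
    intro i j G hG
    by_cases hij : i = j
    · subst hij
      exact ⟨G, hG, ⟨Iso.refl⟩⟩
    · exact hnormal.2 i j hij G hG
  obtain ⟨j, hj⟩ := exists_card_part_eq n (show 0 < r by omega)
  have main : ∀ G ∈ SPEX 𝒢, ∃ i : Fin r, (part n r i).card = n / r ∧ G ∈ inPart 𝒢 i := by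
    intro G hG
    obtain ⟨G₁, hG₁, hmax⟩ :=
      Set.exists_max_image 𝒢 (fun G => W 2 (embedded r G)) 𝒢.toFinite ⟨G, hG.1⟩
    -- All members have `W 1 = 2 * t`, so `EX 2` just selects the maximizers of `W 2`, and the
    -- hypothesis puts their edges into one part.
    have hmem : ∀ K ∈ 𝒢, W 2 (embedded r K) = W 2 (embedded r G₁) → ∃ i : Fin r, K ∈ inPart 𝒢 i := by
      intro K hK hKW
      refine Set.mem_iUnion.1 (hEX ⟨hK, ⟨⟨K, hK, rfl⟩, ?_⟩, ?_⟩)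
      · rintro _ ⟨L, hL, rfl⟩
        exact (W_one_embedded (h𝒢 hL)).trans_le (W_one_embedded (h𝒢 hK)).ge
      · rintro _ hL
        obtain ⟨L, hL', rfl⟩ := EX_subset _ 1 hL
        exact (hmax L hL').trans_eq hKW.symm
    obtain ⟨i₁, hi₁⟩ := hmem G₁ hG₁ rfl
    obtain ⟨G₀, hG₀, hcopy⟩ := copy i₁ j G₁ hi₁
    have hW₀ : W 2 (embedded r G₀) = W 2 (embedded r G₁) := hcopy.W_eq 1
    have hle : ¬ rho G < rho G₀ := not_lt.2 (hG.2 G₀ hG₀.1)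
    rcases (hmax G hG.1).lt_or_eq with hlt | heq
    · refine absurd (rho_lt_of_turanSum_lt hr ht hn1 (h𝒢 hG₀.1) (h𝒢 hG.1) fun x hx => ?_) hle
      exact turanSum_lt_of_W_two_lt hr ht (h𝒢 hG₀.1) (h𝒢 hG.1) hG₀.2 hj (by rwa [hW₀])
        (by linarith) (by linarith)
    · obtain ⟨i, hi⟩ := hmem G hG.1 heq
      refine ⟨i, ?_, hi⟩
      by_contra hne
      have hic : (part n r i).card = n / r + 1 := by
        have h1 := le_card_part (n := n) (show 0 < r by omega) i
        have h2 := card_part_le (n := n) (show 0 < r by omega) i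
        omega
      refine absurd (rho_lt_of_turanSum_lt hr ht hn1 (h𝒢 hG₀.1) (h𝒢 hG.1) fun x hx => ?_) hle
      exact turanSum_lt_of_card_part hr ht (h𝒢 hG₀.1) (h𝒢 hG.1) hi.2 hic hG₀.2 hj
        (heq.trans hW₀.symm) hx (by linarith) (by linarith)
  ext G
  simp only [Set.mem_iUnion, Set.mem_ofPred_eq, exists_prop]
  constructor
  · intro hG
    obtain ⟨i, hi, hGi⟩ := main G hG
    exact ⟨i, hi, hGi, fun G' hG' => hG.2 G' hG'.1⟩
  · rintro ⟨i, hi, hG⟩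
    -- A global maximizer lies in some part of size `⌊n/r⌋`; its copy in part `i`, of equal size,
    -- has the same spectral radius, so a maximizer within part `i` is global.
    obtain ⟨M, hM, hmax⟩ := Set.exists_max_image 𝒢 rho 𝒢.toFinite ⟨G, hG.1.1⟩
    obtain ⟨k, hk, hMk⟩ := main M ⟨hM, hmax⟩
    obtain ⟨M', hM', hcopy⟩ := copy k i M hMk
    have hrho : rho M' = rho M := rho_eq_of_isCopy hr ht hn1 (h𝒢 hM) (h𝒢 hM'.1) hMk.2 hM'.2
      (hk.trans hi.symm) hcopy
    exact ⟨hG.1.1, fun G' hG' => (hmax G' hG').trans (hrho.ge.trans (hG.2 M' hM'))⟩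

end Comparison

end

end SpectralTuran

open SpectralTuran
theorem theorem1p4 (t r : ℕ) (ht : 1 ≤ t) (hr : 2 ≤ r) :
    ∃ N : ℕ, ∀ n : ℕ, N ≤ n → ∀ 𝒢 : Set (SimpleGraph (Fin n)),
      IsNormal n r t 𝒢 →
      {G | G ∈ 𝒢 ∧ embedded r G ∈ EX 2 (embeddedSet r 𝒢)} ⊆ ⋃ i : Fin r, inPart 𝒢 i →
      (SPEX 𝒢 = ⋃ i ∈ {i : Fin r | (part n r i).card = n / r}, SPEX (inPart 𝒢 i)) ∧
      (∀ i : Fin r, ∀ G ∈ inPart 𝒢 i,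
        (G ∈ SPEX (inPart 𝒢 i) ↔ embedded r G ∈ EXinf (embeddedSet r (inPart 𝒢 i)))) := by
  obtain ⟨Q₁, hQ₁⟩ := SPEX_eq_iUnion_inPart t r ht hr
  obtain ⟨Q₂, hQ₂⟩ := mem_SPEX_inPart_iff t r ht hr
  refine ⟨max Q₁ Q₂ * r, fun n hn 𝒢 hnormal hEX => ?_⟩
  have hq : max Q₁ Q₂ ≤ n / r := (Nat.le_div_iff_mul_le (by omega)).2 hn
  exact ⟨hQ₁ n ((le_max_left _ _).trans hq) 𝒢 hnormal hEX,
    hQ₂ n ((le_max_right _ _).trans hq) 𝒢 hnormal.1⟩
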